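/- For $\mu>0$ and $r>0$ let $S_\mu(r)=\sum_{n=1}^\infty \frac{2n}{(n^2+r^2)^{\mu+1}}$ be the generalized Mathieu series, let $J_0(x)=\sum_{k=0}^\infty \frac{(-1)^k}{(k!)^2}\left(\frac{x}{2}\right)^{2k}$ be the Bessel function of the first kind of order $0$, and let $\zeta$ be the Riemann zeta function. Put $$c_L=\sup_{x>0} x^{1/3}J_0(x).$$ Then this supremum is finite, with $c_L=0.78574687\ldots$ (that is, $0.78574687\le c_L<0.78574688$), and for all $\mu>\frac76$ and all $r>0$ the series $S_\mu(r)$ converges and $$S_\mu(r)\le \frac{c_L\sqrt{\pi}\,\Gamma\left(\mu+\frac76\right)\zeta\left(\mu-\frac16\right)}{2^{\mu-1/2}\,\Gamma(\mu+1)\,r^{\mu+7/6}}.$$ -/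

import Mathlib

noncomputable section

/-- The terms of the generalized Mathieu series `S_μ(r) = ∑_{n ≥ 1} 2n / (n² + r²)^(μ+1)`;
the summation index is shifted by one. -/
def mathieuTerm (μ r : ℝ) (n : ℕ) : ℝ :=
  2 * ((n : ℝ) + 1) / (((n : ℝ) + 1) ^ 2 + r ^ 2) ^ (μ + 1)

/-- The sum `S_μ(r)` of the generalized Mathieu series. -/
def mathieuS (μ r : ℝ) : ℝ := ∑' n : ℕ, mathieuTerm μ r n

/-- The Bessel function of the first kind of real order `ν ≥ 0` at a real argument `x > 0`,
`J_ν(x) = ∑_{k ≥ 0} (-1)^k / (k! Γ(k + ν + 1)) (x/2)^(2k + ν)`. -/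
def besselJ (ν x : ℝ) : ℝ :=
  ∑' k : ℕ, (-1 : ℝ) ^ k / ((k.factorial : ℝ) * Real.Gamma ((k : ℝ) + ν + 1)) *
    (x / 2) ^ (2 * (k : ℝ) + ν)

/-- The set of the values `x^(1/3) J_0(x)`, `x > 0`. -/
def landauSet : Set ℝ := (fun x : ℝ => x ^ (1 / 3 : ℝ) * besselJ 0 x) '' Set.Ioi 0

/-- Landau's constant `c_L = sup_{x > 0} x^(1/3) J_0(x)`. -/
def landauC : ℝ := sSup landauSet

/-- The Riemann zeta function at a real argument `s > 1`, where it is real-valued. -/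
def realZeta (s : ℝ) : ℝ := (riemannZeta (s : ℂ)).re

end

/-! The series bound needs no Bessel integral. Splitting the exponent `μ + 1` as `(μ + 5/6) + 1/6`
and using `n² + r² ≥ 2nr` and `n² + r² ≥ r²` bounds each term by a multiple of `n^(1/6 - μ)`, so
zeta appears on summing. The stated constant is larger, because `c_L √π ≥ 1` and Gamma increases on
`[2, ∞)` (`mathieu_const_le`).

The numerical work is in `c_L`. With `t = x² / 4` and `y = x^(1/3)`, the range `t ≤ 1` is handled by
alternating partial sums and a tangent line, the range `x ≥ 2` by a decreasing energy; evaluation at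
`y = 0.921955` gives the lower bound. -/

/-! ### Bessel's equation as a first-order system in `t`. -/

/-- The entire function `∑ (-t)^k / (k!)²`, which satisfies `J₀(x) = besselEntire (x² / 4)`. -/
noncomputable def besselEntire (t : ℝ) : ℝ := ∑' k : ℕ, (-1 : ℝ) ^ k / (k.factorial : ℝ) ^ 2 * t ^ k

/-- The function `-t * besselEntire' t`, as a power series. -/
noncomputable def besselEntireAux (t : ℝ) : ℝ :=
  ∑' k : ℕ, -((k : ℝ) * ((-1 : ℝ) ^ k / (k.factorial : ℝ) ^ 2)) * t ^ k

theorem besselJ_zero_eq (x : ℝ) : besselJ 0 x = besselEntire (x ^ 2 / 4) := by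
  unfold besselJ besselEntire
  refine tsum_congr fun k => ?_
  have h1 : Real.Gamma ((k : ℝ) + 0 + 1) = k.factorial := by
    rw [add_zero, Real.Gamma_nat_eq_factorial]
  have h2 : (x / 2) ^ (2 * (k : ℝ) + 0) = (x ^ 2 / 4) ^ k := by
    rw [add_zero, show (2 * (k : ℝ)) = ((2 * k : ℕ) : ℝ) by push_cast; ring, Real.rpow_natCast,
      pow_mul]
    congr 1
    ring
  rw [h1, h2, ← sq]

theorem summable_nat_mul_pow_pred_div_factorial (R : ℝ) :
    Summable fun k : ℕ => 1 / (k.factorial : ℝ) * (k * R ^ (k - 1)) := by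
  rw [← summable_nat_add_iff 1]
  refine (Real.summable_pow_div_factorial R).congr fun k => ?_
  have := Nat.factorial_ne_zero k
  rw [Nat.factorial_succ, Nat.add_sub_cancel]
  push_cast
  have h1 : (k : ℝ) + 1 ≠ 0 := by positivity
  field_simp

theorem summable_mul_pow_of_abs_le {a : ℕ → ℝ} (ha : ∀ k, |a k| ≤ 1 / (k.factorial : ℝ)) (t : ℝ) :
    Summable fun k => a k * t ^ k := by
  refine Summable.of_norm_bounded (Real.summable_pow_div_factorial |t|) fun k => ?_
  rw [norm_mul, norm_pow, Real.norm_eq_abs, Real.norm_eq_abs, div_eq_mul_one_div, mul_comm]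
  gcongr
  exact ha k

theorem summable_mul_deriv_pow_of_abs_le {a : ℕ → ℝ}
    (ha : ∀ k, |a k| ≤ 1 / (k.factorial : ℝ)) (t : ℝ) :
    Summable fun k : ℕ => a k * (k * t ^ (k - 1)) := by
  refine Summable.of_norm_bounded (summable_nat_mul_pow_pred_div_factorial |t|) fun k => ?_
  rw [norm_mul, norm_mul, norm_pow, Real.norm_eq_abs, Real.norm_eq_abs, Real.norm_eq_abs,
    Nat.abs_cast]
  gcongr
  exact ha k

theorem hasDerivAt_tsum_mul_pow {a : ℕ → ℝ} (ha : ∀ k, |a k| ≤ 1 / (k.factorial : ℝ)) (t : ℝ) :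
    HasDerivAt (fun z => ∑' k, a k * z ^ k) (∑' k, a k * (k * t ^ (k - 1))) t := by
  have ht : t ∈ Metric.ball (0 : ℝ) (|t| + 1) := by simp
  refine hasDerivAt_tsum_of_isPreconnected
    (summable_nat_mul_pow_pred_div_factorial (|t| + 1)) Metric.isOpen_ball
    (convex_ball _ _).isPreconnected (fun k y _ => (hasDerivAt_pow k y).const_mul (a k))
    (fun k y hy => ?_) ht (summable_mul_pow_of_abs_le ha t) ht
  have hy' : |y| ≤ |t| + 1 := (mem_ball_zero_iff.1 hy).le
  rw [norm_mul, norm_mul, norm_pow, Real.norm_eq_abs, Real.norm_eq_abs, Real.norm_eq_abs,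
    Nat.abs_cast]
  gcongr
  exact ha k

theorem abs_besselEntire_coeff_le (k : ℕ) :
    |(-1 : ℝ) ^ k / (k.factorial : ℝ) ^ 2| ≤ 1 / (k.factorial : ℝ) := by
  have h : (1 : ℝ) ≤ k.factorial := by exact_mod_cast Nat.one_le_iff_ne_zero.2 k.factorial_ne_zero
  rw [abs_div, abs_pow, abs_neg, abs_one, one_pow, abs_of_nonneg (by positivity)]
  gcongr
  nlinarith

theorem abs_besselEntireAux_coeff_le (k : ℕ) :
    |-((k : ℝ) * ((-1 : ℝ) ^ k / (k.factorial : ℝ) ^ 2))| ≤ 1 / (k.factorial : ℝ) := by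
  have h : (k : ℝ) ≤ k.factorial := by exact_mod_cast Nat.self_le_factorial k
  have h0 : (0 : ℝ) < k.factorial := by exact_mod_cast k.factorial_pos
  rw [abs_neg, abs_mul, abs_div, abs_pow, abs_neg, abs_one, one_pow, Nat.abs_cast,
    abs_of_nonneg (by positivity : (0 : ℝ) ≤ (k.factorial : ℝ) ^ 2), mul_one_div,
    div_le_div_iff₀ (by positivity) h0]
  nlinarith

theorem hasDerivAt_besselEntire {t : ℝ} (ht : t ≠ 0) :
    HasDerivAt besselEntire (-besselEntireAux t / t) t := by
  refine (hasDerivAt_tsum_mul_pow abs_besselEntire_coeff_le t).congr_deriv (Eq.symm ?_)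
  rw [div_eq_iff ht, besselEntireAux, ← tsum_neg, ← tsum_mul_right]
  refine tsum_congr fun k => ?_
  rcases k with _ | k
  · simp
  · rw [Nat.add_sub_cancel, pow_succ t k]
    ring

theorem hasDerivAt_besselEntireAux (t : ℝ) :
    HasDerivAt besselEntireAux (besselEntire t) t := by
  refine (hasDerivAt_tsum_mul_pow abs_besselEntireAux_coeff_le t).congr_deriv (Eq.symm ?_)
  rw [(summable_mul_deriv_pow_of_abs_le abs_besselEntireAux_coeff_le t).tsum_eq_zero_add,
    besselEntire]
  simp only [Nat.cast_zero, zero_mul, mul_zero, zero_add]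
  refine tsum_congr fun k => ?_
  rw [Nat.add_sub_cancel, Nat.factorial_succ]
  have := Nat.factorial_ne_zero k
  have h1 : (k : ℝ) + 1 ≠ 0 := by positivity
  push_cast
  field_simp
  ring

/-! ### Alternating-series enclosures. -/

theorem alternating_tsum_bounds {a : ℕ → ℝ} (ha : Antitone a) {b : ℕ → ℝ}
    (hb : ∀ k, b k = (-1) ^ k * a k) (hs : Summable b) (m : ℕ) :
    ∑ k ∈ Finset.range (2 * m), b k ≤ ∑' k, b k ∧
      ∑' k, b k ≤ ∑ k ∈ Finset.range (2 * m + 1), b k := by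
  obtain rfl : b = fun k => (-1) ^ k * a k := funext hb
  exact ⟨ha.alternating_series_le_tendsto hs.hasSum.tendsto_sum_nat m,
    ha.tendsto_le_alternating_series hs.hasSum.tendsto_sum_nat m⟩

theorem besselEntire_bounds {t : ℝ} (h0 : 0 ≤ t) (h1 : t ≤ 1) :
    1 - t + t ^ 2 / 4 - t ^ 3 / 36 + t ^ 4 / 576 - t ^ 5 / 14400 ≤ besselEntire t ∧
      besselEntire t ≤ 1 - t + t ^ 2 / 4 - t ^ 3 / 36 + t ^ 4 / 576 := by
  have hs := summable_mul_pow_of_abs_le abs_besselEntire_coeff_le t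
  have ha : Antitone fun k : ℕ => t ^ k / (k.factorial : ℝ) ^ 2 := by
    refine antitone_nat_of_succ_le fun k => ?_
    have hk : (k.factorial : ℝ) ≤ (k + 1).factorial := by
      exact_mod_cast Nat.factorial_le (Nat.le_succ k)
    have hk0 : (0 : ℝ) < k.factorial := by exact_mod_cast k.factorial_pos
    have := pow_le_pow_of_le_one h0 h1 (Nat.le_succ k)
    gcongr
  have key := alternating_tsum_bounds ha (fun k => by ring) hs
  have e3 := (key 3).1
  have e2 := (key 2).2
  norm_num [Finset.sum_range_succ, Nat.factorial] at e2 e3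
  rw [← besselEntire] at e2 e3
  constructor <;> linarith

theorem besselEntireAux_one_bounds :
    0.576 ≤ besselEntireAux 1 ∧ besselEntireAux 1 ≤ 0.577 := by
  have hs := summable_mul_pow_of_abs_le abs_besselEntireAux_coeff_le 1
  -- The zeroth term vanishes; without it the absolute values of the terms decrease.
  have hs' := (summable_nat_add_iff 1).2 hs
  have e := hs.tsum_eq_zero_add
  have ha : Antitone fun k : ℕ => ((k : ℝ) + 1) / ((k + 1).factorial : ℝ) ^ 2 := by
    refine antitone_nat_of_succ_le fun k => ?_
    have hk0 : (0 : ℝ) < (k + 1).factorial := by exact_mod_cast (k + 1).factorial_pos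
    rw [div_le_div_iff₀ (by positivity) (by positivity), Nat.factorial_succ (k + 1)]
    push_cast
    rw [mul_pow, ← mul_assoc]
    refine mul_le_mul_of_nonneg_right ?_ (by positivity)
    have : (0 : ℝ) ≤ k := k.cast_nonneg
    nlinarith [mul_nonneg this this, mul_nonneg this (mul_nonneg this this)]
  have key := alternating_tsum_bounds ha (fun k => by push_cast; ring) hs'
  have e3 := (key 2).1
  have e2 := (key 2).2
  rw [← besselEntireAux] at e
  simp only [Nat.cast_zero, zero_mul, neg_zero, zero_add] at e
  rw [← e] at e2 e3
  norm_num [Finset.sum_range_succ, Nat.factorial] at e2 e3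
  constructor <;> linarith

/-! ### Energy decay for `x ≥ 2`. -/

/-- The Sturm energy of `√x J₀(x)`, up to the factor `√t`, in the variable `t = x² / 4`. -/
noncomputable def besselEnergy (t : ℝ) : ℝ :=
  2 * besselEntireAux t ^ 2 - besselEntire t * besselEntireAux t + besselEntire t ^ 2 / 4 +
    2 * t * besselEntire t ^ 2

theorem hasDerivAt_besselEnergy {t : ℝ} (ht : t ≠ 0) :
    HasDerivAt besselEnergy
      (besselEntireAux t ^ 2 / t + besselEntire t ^ 2 -
        besselEntire t * besselEntireAux t / (2 * t)) t := by
  have hf := hasDerivAt_besselEntire ht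
  have hg := hasDerivAt_besselEntireAux t
  have := ((((hg.fun_pow 2).const_mul 2).fun_sub (hf.fun_mul hg)).fun_add
    ((hf.fun_pow 2).div_const 4)).fun_add (((hasDerivAt_id' t).const_mul 2).fun_mul (hf.fun_pow 2))
  refine this.congr_deriv ?_
  field_simp
  ring

/-- With `u = √x J₀(x)` and `q = 1 + 1/(4x²)`, Bessel's equation reads `u'' + q u = 0`. The quotient
is `u'² + q u²`, whose `x`-derivative is `q' u² ≤ 0`. -/
theorem antitoneOn_besselEnergy_div_sqrt :
    AntitoneOn (fun t => besselEnergy t / Real.sqrt t) (Set.Ici 1) := by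
  have hd : ∀ t : ℝ, 0 < t → HasDerivAt (fun t => besselEnergy t / Real.sqrt t)
      (-(besselEntire t ^ 2 / (8 * t * Real.sqrt t))) t := by
    intro t ht
    have hs := Real.sqrt_pos.2 ht
    refine ((hasDerivAt_besselEnergy ht.ne').fun_div (Real.hasDerivAt_sqrt ht.ne')
      hs.ne').congr_deriv ?_
    obtain ⟨s, rfl⟩ : ∃ s, s = Real.sqrt t := ⟨_, rfl⟩
    have h2 : Real.sqrt t ^ 2 = t := Real.sq_sqrt ht.le
    generalize Real.sqrt t = s at *
    subst h2
    unfold besselEnergy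
    field_simp
    ring
  refine antitoneOn_of_deriv_nonpos (convex_Ici 1)
    (fun t ht => (hd t (zero_lt_one.trans_le ht)).continuousAt.continuousWithinAt)
    (fun t ht => ?_) (fun t ht => ?_) <;>
  rw [interior_Ici] at ht
  · exact (hd t (zero_lt_one.trans ht)).differentiableAt.differentiableWithinAt
  · have ht' : (0 : ℝ) < t := zero_lt_one.trans ht
    rw [(hd t ht').deriv]
    exact neg_nonpos.2 (by positivity)

theorem mul_sq_besselEntire_le {x : ℝ} (hx : 2 ≤ x) :
    x * besselEntire (x ^ 2 / 4) ^ 2 ≤ 0.66 := by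
  have hx0 : 0 < x := by linarith
  have ht : (1 : ℝ) ≤ x ^ 2 / 4 := by nlinarith
  have h := antitoneOn_besselEnergy_div_sqrt (Set.mem_Ici.2 le_rfl) (Set.mem_Ici.2 ht) ht
  have hs : Real.sqrt (x ^ 2 / 4) = x / 2 := by
    rw [show x ^ 2 / 4 = (x / 2) ^ 2 by ring, Real.sqrt_sq (by positivity)]
  have h1 : besselEnergy 1 ≤ 0.66 := by
    obtain ⟨g1, g2⟩ := besselEntireAux_one_bounds
    obtain ⟨f1, f2⟩ := besselEntire_bounds zero_le_one le_rfl
    norm_num at f1 f2 g1 g2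
    unfold besselEnergy
    nlinarith
  simp only [hs, Real.sqrt_one, div_one] at h
  rw [div_le_iff₀ (by positivity)] at h
  -- The rest of the energy is `2(g - f/4)² + f²/8`, where `f` is `besselEntire` and `g` is
  -- `besselEntireAux`.
  have h2 : x ^ 2 / 2 * besselEntire (x ^ 2 / 4) ^ 2 ≤ besselEnergy (x ^ 2 / 4) := by
    unfold besselEnergy
    nlinarith [sq_nonneg (besselEntireAux (x ^ 2 / 4) - besselEntire (x ^ 2 / 4) / 4),
      sq_nonneg (besselEntire (x ^ 2 / 4))]
  have h3 : x / 2 * (x * besselEntire (x ^ 2 / 4) ^ 2) ≤ x / 2 * 0.66 := by nlinarith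
  exact le_of_mul_le_mul_left h3 (by positivity)

/-! ### Landau's constant. -/

theorem mul_besselEntire_le_of_le {y : ℝ} (hy : 0 < y) (h : y ^ 6 / 4 ≤ 1) :
    y * besselEntire (y ^ 6 / 4) ≤ 0.785746879 := by
  have hb := (besselEntire_bounds (by positivity) h).2
  -- As a function of `t = y^6/4`, `y` is concave, hence below its tangent at `y = 0.921955`, close
  -- to the maximizer. This leaves a polynomial inequality in `t`.
  have htan : y ≤ 0.921955 * 5 / 6 + 2 / 3 / 0.921955 ^ 5 * (y ^ 6 / 4) := by
    have key : ∀ s : ℝ, 0 ≤ s → 6 * s ≤ s ^ 6 + 5 := fun s hs => by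
      nlinarith [mul_nonneg (sq_nonneg (s - 1))
        (by positivity : 0 ≤ s ^ 4 + 2 * s ^ 3 + 3 * s ^ 2 + 4 * s + 5)]
    have := key (y / 0.921955) (by positivity)
    rw [div_pow] at this
    norm_num at this ⊢
    linarith
  have hP : 0 ≤ 1 - y ^ 6 / 4 + (y ^ 6 / 4) ^ 2 / 4 - (y ^ 6 / 4) ^ 3 / 36 +
      (y ^ 6 / 4) ^ 4 / 576 := by
    have h0 : 0 ≤ y ^ 6 / 4 := by positivity
    generalize y ^ 6 / 4 = t at *
    nlinarith [pow_nonneg h0 4, mul_nonneg (pow_nonneg h0 2) (sub_nonneg.2 h)]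
  refine (mul_le_mul_of_nonneg_left hb hy.le).trans
    ((mul_le_mul_of_nonneg_right htan hP).trans ?_)
  have h0 : 0 ≤ y ^ 6 / 4 := by positivity
  generalize y ^ 6 / 4 = t at *
  norm_num at *
  have h1 : 0 ≤ 1 - t := sub_nonneg.2 h
  -- The gap nearly has a double zero at `0.921955^6 / 4 ≈ 0.153532`, hence these squares.
  linarith [sq_nonneg (t - 153532 / 1000000), sq_nonneg (t - 1535322 / 10000000),
    mul_nonneg (sq_nonneg (t - 153532 / 1000000)) h1,
    mul_nonneg (sq_nonneg (t - 153532 / 1000000)) (pow_nonneg h0 2),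
    mul_nonneg (sq_nonneg (t - 153532 / 1000000)) (pow_nonneg h0 3),
    mul_nonneg (sq_nonneg (t - 153532 / 1000000)) (mul_nonneg (pow_nonneg h0 2) h1)]

theorem mul_besselEntire_le_of_ge {y : ℝ} (hy : 0 < y) (h : 2 ≤ y ^ 3) :
    y * besselEntire (y ^ 6 / 4) ≤ 0.785746879 := by
  have h1 := mul_sq_besselEntire_le h
  rw [← pow_mul] at h1
  -- Since `1.25³ < 2`; then `(y J₀)² = x J₀² / y ≤ 0.66 / 1.25`, well below the square of the
  -- target.
  have hy1 : 1.25 ≤ y := by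
    by_contra! hlt
    have := pow_lt_pow_left₀ hlt hy.le (n := 3) (by norm_num)
    norm_num at this
    linarith
  refine abs_le_of_sq_le_sq' ?_ (by norm_num) |>.2
  norm_num at *
  nlinarith [mul_nonneg (sub_nonneg.2 hy1) (sq_nonneg (y * besselEntire (y ^ 6 / 4)))]

theorem landau_value_eq {x : ℝ} (hx : 0 < x) :
    x ^ (1 / 3 : ℝ) * besselJ 0 x =
      x ^ (1 / 3 : ℝ) * besselEntire ((x ^ (1 / 3 : ℝ)) ^ 6 / 4) := by
  rw [besselJ_zero_eq x, ← Real.rpow_natCast (x ^ (1 / 3 : ℝ)), ← Real.rpow_mul hx.le,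
    ← Real.rpow_natCast x 2]
  norm_num

theorem landau_value_le {x : ℝ} (hx : 0 < x) : x ^ (1 / 3 : ℝ) * besselJ 0 x ≤ 0.785746879 := by
  rw [landau_value_eq hx]
  have hy : 0 < x ^ (1 / 3 : ℝ) := by positivity
  rcases le_total 2 ((x ^ (1 / 3 : ℝ)) ^ 3) with h | h
  · exact mul_besselEntire_le_of_ge hy h
  · refine mul_besselEntire_le_of_le hy ?_
    have : 0 < (x ^ (1 / 3 : ℝ)) ^ 3 := by positivity
    nlinarith

theorem exists_landau_value_ge : ∃ z ∈ landauSet, 0.78574687 ≤ z := by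
  refine ⟨_, ⟨(0.921955 : ℝ) ^ 3, Set.mem_Ioi.2 (by positivity), rfl⟩, ?_⟩
  have hy : ((0.921955 : ℝ) ^ 3) ^ (1 / 3 : ℝ) = 0.921955 := by
    rw [← Real.rpow_natCast, ← Real.rpow_mul (by norm_num)]
    norm_num
  have := (besselEntire_bounds (t := (0.921955 : ℝ) ^ 6 / 4) (by positivity) (by norm_num)).1
  simp only
  rw [landau_value_eq (by positivity), hy]
  refine le_trans ?_ (mul_le_mul_of_nonneg_left this (by norm_num))
  norm_num

theorem isLUB_landauC : IsLUB landauSet landauC := by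
  refine isLUB_csSup (exists_landau_value_ge.imp fun _ h => h.1) ⟨0.785746879, ?_⟩
  rintro _ ⟨x, hx, rfl⟩
  exact landau_value_le hx

theorem le_landauC : 0.78574687 ≤ landauC := by
  obtain ⟨z, hz, h⟩ := exists_landau_value_ge
  exact h.trans (isLUB_landauC.1 hz)

theorem landauC_le : landauC ≤ 0.785746879 := by
  refine isLUB_landauC.2 ?_
  rintro _ ⟨x, hx, rfl⟩
  exact landau_value_le hx

/-! ### The Mathieu series. -/

/-- The weighted arithmetic-geometric mean estimate behind the bound of a single term. -/
theorem rpow_mul_rpow_le {μ n r : ℝ} (hμ : 0 < μ) (hn : 0 < n) (hr : 0 < r) :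
    n ^ (μ + 5 / 6) * r ^ (μ + 7 / 6) * 2 ^ (μ + 5 / 6) ≤ (n ^ 2 + r ^ 2) ^ (μ + 1) := by
  have h1 : (2 * (n * r)) ^ (μ + 5 / 6) ≤ (n ^ 2 + r ^ 2) ^ (μ + 5 / 6) :=
    Real.rpow_le_rpow (by positivity) (by nlinarith [sq_nonneg (n - r)]) (by positivity)
  have h2 : r ^ (1 / 3 : ℝ) ≤ (n ^ 2 + r ^ 2) ^ (1 / 6 : ℝ) := by
    calc r ^ (1 / 3 : ℝ) = (r ^ 2) ^ (1 / 6 : ℝ) := by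
          rw [← Real.rpow_natCast r 2, ← Real.rpow_mul hr.le]; norm_num
      _ ≤ _ := Real.rpow_le_rpow (by positivity) (by nlinarith [sq_nonneg n]) (by norm_num)
  calc n ^ (μ + 5 / 6) * r ^ (μ + 7 / 6) * 2 ^ (μ + 5 / 6)
      = (2 * (n * r)) ^ (μ + 5 / 6) * r ^ (1 / 3 : ℝ) := by
        rw [show μ + 7 / 6 = (μ + 5 / 6) + 1 / 3 by ring, Real.rpow_add hr,
          Real.mul_rpow zero_le_two (by positivity), Real.mul_rpow hn.le hr.le]
        ring
    _ ≤ (n ^ 2 + r ^ 2) ^ (μ + 5 / 6) * (n ^ 2 + r ^ 2) ^ (1 / 6 : ℝ) := by gcongr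
    _ = (n ^ 2 + r ^ 2) ^ (μ + 1) := by
        rw [← Real.rpow_add (by positivity)]; ring_nf

theorem mathieuTerm_le {μ r : ℝ} (hμ : 0 < μ) (hr : 0 < r) (n : ℕ) :
    mathieuTerm μ r n ≤
      1 / (2 ^ (μ - 1 / 6) * r ^ (μ + 7 / 6)) * (1 / ((n : ℝ) + 1) ^ (μ - 1 / 6)) := by
  have hn : (0 : ℝ) < (n : ℝ) + 1 := by positivity
  have h := rpow_mul_rpow_le hμ hn hr
  unfold mathieuTerm
  generalize (n : ℝ) + 1 = m at *
  rw [one_div_mul_one_div, div_le_div_iff₀ (by positivity) (by positivity), one_mul]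
  refine le_trans (le_of_eq ?_) h
  rw [show μ + 5 / 6 = (μ - 1 / 6) + 1 by ring, Real.rpow_add hn, Real.rpow_add zero_lt_two,
    Real.rpow_one, Real.rpow_one]
  ring

theorem hasSum_realZeta {s : ℝ} (hs : 1 < s) :
    HasSum (fun n : ℕ => 1 / ((n : ℝ) + 1) ^ s) (realZeta s) := by
  have hsum : Summable fun n : ℕ => 1 / ((n : ℝ) + 1) ^ s := by
    have := (summable_nat_add_iff 1).2 (Real.summable_one_div_nat_rpow.2 hs)
    simpa using this
  have e : realZeta s = ∑' n : ℕ, 1 / ((n : ℝ) + 1) ^ s := by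
    rw [realZeta, zeta_eq_tsum_one_div_nat_add_one_cpow (by simpa using hs)]
    have : ∀ n : ℕ, 1 / ((n : ℂ) + 1) ^ (s : ℂ) = ((1 / ((n : ℝ) + 1) ^ s : ℝ) : ℂ) := fun n => by
      push_cast [Complex.ofReal_cpow (by positivity : (0 : ℝ) ≤ (n : ℝ) + 1)]
      rfl
    rw [tsum_congr this, ← Complex.ofReal_tsum, Complex.ofReal_re]
  exact e ▸ hsum.hasSum

theorem one_le_landauC_mul_sqrt_pi : 1 ≤ landauC * Real.sqrt Real.pi := by
  have h : (1.5 : ℝ) ≤ Real.sqrt Real.pi :=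
    Real.le_sqrt_of_sq_le (by norm_num; linarith [Real.pi_gt_three])
  have := le_landauC
  norm_num at *
  nlinarith

theorem mathieu_const_le {μ r : ℝ} (hμ : 1 ≤ μ) (hr : 0 < r) :
    1 / (2 ^ (μ - 1 / 6) * r ^ (μ + 7 / 6)) ≤
      landauC * Real.sqrt Real.pi * Real.Gamma (μ + 7 / 6) /
        (2 ^ (μ - 1 / 2) * Real.Gamma (μ + 1) * r ^ (μ + 7 / 6)) := by
  -- Monotonicity of Gamma is available from 2 on, so `μ ≥ 1` is what puts `μ + 1` in range.
  have hG : Real.Gamma (μ + 1) ≤ Real.Gamma (μ + 7 / 6) :=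
    Real.Gamma_strictMonoOn_Ici.monotoneOn (Set.mem_Ici.2 (by linarith))
      (Set.mem_Ici.2 (by linarith)) (by linarith)
  have hG0 : 0 < Real.Gamma (μ + 1) := Real.Gamma_pos_of_pos (by linarith)
  have h2 : (2 : ℝ) ^ (μ - 1 / 2) ≤ 2 ^ (μ - 1 / 6) :=
    Real.rpow_le_rpow_of_exponent_le one_le_two (by linarith)
  have hc := one_le_landauC_mul_sqrt_pi
  rw [div_le_div_iff₀ (by positivity) (by positivity), one_mul, ← mul_assoc]
  refine mul_le_mul_of_nonneg_right ?_ (by positivity)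
  rw [mul_comm]
  refine mul_le_mul ?_ h2 (by positivity) (by nlinarith)
  nlinarith

theorem mainTheorem8 :
    (IsLUB landauSet landauC ∧ (0.78574687 : ℝ) ≤ landauC ∧ landauC < (0.78574688 : ℝ)) ∧
    ∀ μ r : ℝ, 7 / 6 < μ → 0 < r →
      Summable (mathieuTerm μ r) ∧
      mathieuS μ r ≤
        landauC * Real.sqrt Real.pi * Real.Gamma (μ + 7 / 6) * realZeta (μ - 1 / 6) /
          ((2 : ℝ) ^ (μ - 1 / 2) * Real.Gamma (μ + 1) * r ^ (μ + 7 / 6)) := by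
  refine ⟨⟨isLUB_landauC, le_landauC, landauC_le.trans_lt (by norm_num)⟩, fun μ r hμ hr => ?_⟩
  have hζ := hasSum_realZeta (s := μ - 1 / 6) (by linarith)
  have hle := mathieuTerm_le (μ := μ) (r := r) (by linarith) hr
  have hmaj := hζ.mul_left (1 / (2 ^ (μ - 1 / 6) * r ^ (μ + 7 / 6)))
  have hsum : Summable (mathieuTerm μ r) :=
    hmaj.summable.of_nonneg_of_le (fun n => by unfold mathieuTerm; positivity) hle
  refine ⟨hsum, (hsum.tsum_le_tsum hle hmaj.summable).trans ?_⟩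
  rw [hmaj.tsum_eq]
  have hζ0 : 0 ≤ realZeta (μ - 1 / 6) := hζ.nonneg fun n => by positivity
  refine (mul_le_mul_of_nonneg_right (mathieu_const_le (by linarith) hr) hζ0).trans_eq ?_
  ring
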